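/- Let $S_n$ be the symmetric group on $[n]=\{1,\dots,n\}$ ($n\ge 0$). A permutation $\pi\in S_n$ avoids $231$ if there are no $a<b<c$ in $[n]$ with $\pi(c)<\pi(a)<\pi(b)$. Let $c_k(\pi)$ be the number of $k$-cycles of $\pi$ (fixed points being the $1$-cycles). For a set $S$ of positive integers let $S_n^S(231)$ be the set of $231$-avoiding $\pi\in S_n$ all of whose cycle lengths lie in $S$, and let $A^S_{231}(z)=\sum_{n\ge 0}|S_n^S(231)|\,z^n$. Define the formal power series $$B(t,x,y)=\sum_{i,j,k\ge 0}\ \sum_{n\ge 0}\bigl|\{\pi\in S_n^{\{1,2,3\}}(231): c_1(\pi)=i,\ c_2(\pi)=j,\ c_3(\pi)=k\}\bigr|\;t^i x^j y^k .$$ Theorem. As formal power series over $\mathbb{Q}$, $$B(t,x,y)=\frac{(1-x)^2(1-2y)}{1-3x-3y-t+2x^2+5xy+tx-5x^2y-4txy-t^2y}.$$ Moreover, for every $S\subseteq\{1,2,3\}$, $$A^S_{231}(z)=B(\varepsilon_1 z,\ \varepsilon_2 z^2,\ \varepsilon_3 z^3),\qquad \varepsilon_m=\begin{cases}1& m\in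 S\\ 0& m\notin S,\end{cases}$$ so $A^S_{231}(z)$ is given by the rational function above with $t=\varepsilon_1 z$, $x=\varepsilon_2 z^2$, $y=\varepsilon_3 z^3$. -/

import Mathlib

namespace CyclePattern

open Equiv

/-- `π ∈ S_n` contains the pattern `σ ∈ S_k`: some subsequence of `π 0, …, π (n-1)` is in the same
relative order as `σ 0, …, σ (k-1)`. Permutations of `[n]` are permutations of `Fin n`. -/
def Contains {n k : ℕ} (π : Perm (Fin n)) (σ : Perm (Fin k)) : Prop :=
  ∃ f : Fin k ↪o Fin n, ∀ i j : Fin k, π (f i) < π (f j) ↔ σ i < σ j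

def Avoids {n k : ℕ} (π : Perm (Fin n)) (σ : Perm (Fin k)) : Prop := ¬ Contains π σ

/-- The pattern 231, shifted to the letters `0, 1, 2`. -/
def p231 : Perm (Fin 3) where
  toFun := ![1, 2, 0]
  invFun := ![2, 0, 1]
  left_inv := by decide
  right_inv := by decide

/-- `c_k(π)`: the number of `k`-cycles of `π`; fixed points are the `1`-cycles.
(`Equiv.Perm.partition` lists all cycle lengths, fixed points included.) -/
def cycleCount {n : ℕ} (k : ℕ) (π : Perm (Fin n)) : ℕ := π.partition.parts.count k

/-- All cycle lengths of `π` (fixed points have length `1`) lie in `S`. -/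
def CyclesIn {n : ℕ} (S : Set ℕ) (π : Perm (Fin n)) : Prop := ∀ k ∈ π.partition.parts, k ∈ S

/-- `S_n^S(σ)`. -/
def avoiders (n : ℕ) (S : Set ℕ) {k : ℕ} (σ : Perm (Fin k)) : Set (Perm (Fin n)) :=
  {π | CyclesIn S π ∧ Avoids π σ}

/-- `A^S_σ(z) = ∑ₙ |S_n^S(σ)| zⁿ`. -/
noncomputable def genA (S : Set ℕ) {k : ℕ} (σ : Perm (Fin k)) : PowerSeries ℚ :=
  PowerSeries.mk fun n => ((avoiders n S σ).ncard : ℚ)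

/-- Permutations in `S_n^{{1,2,3}}(231)` with `i` fixed points, `j` 2-cycles and `k` 3-cycles. -/
def refined (n i j k : ℕ) : Set (Perm (Fin n)) :=
  {π ∈ avoiders n {1, 2, 3} p231 |
    cycleCount 1 π = i ∧ cycleCount 2 π = j ∧ cycleCount 3 π = k}

/-- The series `B(t,x,y)`, where `t`, `x`, `y` are the variables of index `0`, `1`, `2`:
the coefficient of `tⁱ xʲ yᵏ` is `∑ₙ |refined n i j k|`, a sum with at most one nonzero term
(see `refined_eq_empty`). -/
noncomputable def genB : MvPowerSeries (Fin 3) ℚ :=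
  fun d => ((∑ᶠ n : ℕ, (refined n (d 0) (d 1) (d 2)).ncard : ℕ) : ℚ)

/-- `refined n i j k` is empty unless `n = i + 2j + 3k`. -/
theorem refined_eq_empty {n i j k : ℕ} (h : n ≠ i + 2 * j + 3 * k) : refined n i j k = ∅ := by
  ext π
  simp only [refined, avoiders, CyclesIn, cycleCount, Set.mem_ofPred_eq, Set.mem_empty_iff_false,
    iff_false]
  rintro ⟨⟨hS, -⟩, rfl, rfl, rfl⟩
  apply h
  have hs : π.partition.parts.sum = n := π.partition.parts_sum.trans (Fintype.card_fin n)
  generalize π.partition.parts = m at hS hs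
  rw [← hs]
  clear h hs
  induction m using Multiset.induction_on with
  | empty => simp
  | cons a m ih =>
    have hm : m.sum = m.count 1 + 2 * m.count 2 + 3 * m.count 3 :=
      ih fun k hk => hS k (Multiset.mem_cons_of_mem hk)
    have ha := hS a (Multiset.mem_cons_self a m)
    simp only [Set.mem_insert_iff, Set.mem_singleton_iff] at ha
    rw [Multiset.sum_cons, Multiset.count_cons, Multiset.count_cons, Multiset.count_cons]
    rcases ha with rfl | rfl | rfl <;> norm_num <;> omega

theorem coeff_genB (d : Fin 3 →₀ ℕ) :
    MvPowerSeries.coeff d genB =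
      ((refined (d 0 + 2 * d 1 + 3 * d 2) (d 0) (d 1) (d 2)).ncard : ℚ) := by
  change ((∑ᶠ n : ℕ, (refined n (d 0) (d 1) (d 2)).ncard : ℕ) : ℚ) = _
  rw [finsum_eq_single _ (d 0 + 2 * d 1 + 3 * d 2)]
  intro n hn
  rw [refined_eq_empty hn, Set.ncard_empty]

/-- The substitution `t = z [1 ∈ S]`, `x = z² [2 ∈ S]`, `y = z³ [3 ∈ S]`. -/
noncomputable def specialization (S : Finset ℕ) : Fin 3 → PowerSeries ℚ :=
  ![if 1 ∈ S then PowerSeries.X else 0,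
    if 2 ∈ S then PowerSeries.X ^ 2 else 0,
    if 3 ∈ S then PowerSeries.X ^ 3 else 0]

/-- Substituting `specialization S` into a power series is legitimate. -/
theorem hasSubst_specialization (S : Finset ℕ) :
    MvPowerSeries.HasSubst (specialization S : Fin 3 → MvPowerSeries Unit ℚ) := by
  apply MvPowerSeries.hasSubst_of_constantCoeff_zero
  intro s
  change PowerSeries.constantCoeff (specialization S s) = 0
  fin_cases s <;> simp [specialization] <;> split_ifs <;> simp

/-- `(1-x)²(1-2y)`. -/
def numB {R : Type*} [CommRing R] (x y : R) : R := (1 - x) ^ 2 * (1 - 2 * y)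

/-- `1 - 3x - 3y - t + 2x² + 5xy + tx - 5x²y - 4txy - t²y`. -/
def denB {R : Type*} [CommRing R] (t x y : R) : R :=
  1 - 3 * x - 3 * y - t + 2 * x ^ 2 + 5 * x * y + t * x - 5 * x ^ 2 * y - 4 * t * x * y
    - t ^ 2 * y

end CyclePattern

/-!
Give a permutation the weight `∏ u k` over its cycle lengths `k`, where `u` vanishes beyond `3`, and
let `W` be the series `∑ₙ wₙ zⁿ` of total weights `wₙ` of the `231`-avoiders of size `n`. The weight
is multiplicative on invariant sets (`weightSum_mul`), so removing invariant pieces gives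
recurrences. Below, `t = u₁ z`, `x = u₂ z²`, `y = u₃ z³`.

* An avoider is the direct sum of a smaller avoider and one that begins with its largest letter
  (`weightSum_avoids`).
* An avoider beginning with its largest letter maps the first position to the last, and this cycle
  has length at most `3`. If the last position is mapped back to the first, the final letter is the
  smallest and the permutation is decreasing; so is the permutation of one letter. Otherwise there
  is an outer `3`-cycle first `→` last `→ j →` first (`isTop_iff`).
* Decreasing permutations have the series `D = (1 + t) / (1 - x)`.
* Removing the outer `3`-cycle leaves an arbitrary avoider with a cut `s` such that the positions
  before the cut carry decreasing letters and the values after it appear in decreasing order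
  (`weightSum_hasOuterCycle`). So the series `T` of permutations with an outer `3`-cycle is `y P`,
  where `P` counts these pairs.
* In such a pair, either the cut is invariant and the permutation is a direct sum of two decreasing
  ones; or the permutation is decreasing and the cut lies strictly inside; or the permutation has
  itself an outer `3`-cycle through `j`, and `s` is `j` or `j + 1`
  (`weightSum_isDoublyDecreasing`). Hence `P = D² + E + 2 T`, where `E` counts decreasing
  permutations with an inner cut.

Eliminating gives `W = 1 / (2 - D - T)` as a rational function (`avoiderSeries_mul_denB`). Indicator
weights yield `genA`. For `genB` the weights are the variables themselves; the size is then
determined by the numbers of cycles, so `z` can be set to `1` (`genB_eq_setSizeOne`).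
-/

namespace CyclePattern

open Equiv

/-! ### Weighted sums over permutations -/

section Weights

variable {R : Type*} [CommRing R]

/-- The weight of a permutation: the product of `u k` over its cycle lengths `k`, fixed points
included. -/
def cycleWeight (u : ℕ → R) {n : ℕ} (π : Perm (Fin n)) : R := (π.partition.parts.map u).prod

open Classical in
/-- The total weight of the permutations of `Fin n` with the property `A`. -/
noncomputable def weightSum (u : ℕ → R) (n : ℕ) (A : Perm (Fin n) → Prop) : R :=
  ∑ π : Perm (Fin n), if A π then cycleWeight u π else 0

theorem cycleWeight_eq (u : ℕ → R) {n : ℕ} (π : Perm (Fin n)) :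
    cycleWeight u π = (π.cycleType.map u).prod * u 1 ^ (n - π.cycleType.sum) := by
  simp [cycleWeight, Perm.parts_partition, Perm.sum_cycleType]

theorem weightSum_eq_zero (u : ℕ → R) {n : ℕ} {A : Perm (Fin n) → Prop}
    (h : ∀ π, ¬ A π) : weightSum u n A = 0 := by
  simp [weightSum, h]

theorem weightSum_eq_of_unique (u : ℕ → R) {n : ℕ} {A : Perm (Fin n) → Prop} (ρ : Perm (Fin n))
    (h : ∀ π, A π ↔ π = ρ) : weightSum u n A = cycleWeight u ρ := by
  simp [weightSum, h]

theorem weightSum_or (u : ℕ → R) {n : ℕ} {A B C : Perm (Fin n) → Prop}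
    (h : ∀ π, A π ↔ B π ∨ C π) (hd : ∀ π, B π → ¬ C π) :
    weightSum u n A = weightSum u n B + weightSum u n C := by
  classical
  rw [weightSum, weightSum, weightSum, ← Finset.sum_add_distrib]
  refine Finset.sum_congr rfl fun π _ => ?_
  by_cases hB : B π
  · simp [h, hB, hd π hB]
  · simp [h, hB]

theorem weightSum_exists (u : ℕ → R) {n m : ℕ} {A : Perm (Fin n) → Prop}
    {B : ℕ → Perm (Fin n) → Prop}
    (h : ∀ π, A π ↔ ∃ j < m, B j π) (hd : ∀ π i j, B i π → B j π → i = j) :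
    weightSum u n A = ∑ j ∈ Finset.range m, weightSum u n (B j) := by
  classical
  simp only [weightSum]
  rw [Finset.sum_comm]
  refine Finset.sum_congr rfl fun π _ => ?_
  by_cases hA : A π
  · obtain ⟨j, hj, hB⟩ := (h π).1 hA
    rw [if_pos hA, Finset.sum_eq_single_of_mem j (Finset.mem_range.2 hj), if_pos hB]
    exact fun i _ hi => if_neg fun hBi => hi (hd π i j hBi hB)
  · rw [if_neg hA, Finset.sum_eq_zero]
    exact fun j hj => if_neg fun hB => hA ((h π).2 ⟨j, Finset.mem_range.1 hj, hB⟩)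

/-- If every cycle length of nonzero weight is at most `3`, then a permutation of nonzero weight
has all its orbits of length at most `3`. -/
theorem orbit_of_cycleWeight_ne_zero {u : ℕ → R} (hu : ∀ k, 3 < k → u k = 0) {n : ℕ}
    {π : Perm (Fin n)} (h : cycleWeight u π ≠ 0) (a : Fin n) :
    π a = a ∨ π (π a) = a ∨ π (π (π a)) = a := by
  by_cases ha : π a = a
  · exact Or.inl ha
  have hmem : (π.cycleOf a).support.card ∈ π.cycleType := by
    rw [Perm.cycleType_def]
    exact Multiset.mem_map.2 ⟨π.cycleOf a, Finset.mem_def.1 <|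
      Perm.cycleOf_mem_cycleFactorsFinset_iff.2 (Perm.mem_support.2 ha), rfl⟩
  have hle : (π.cycleOf a).support.card ≤ 3 := by
    by_contra hlt
    apply h
    rw [cycleWeight_eq, Multiset.prod_eq_zero (Multiset.mem_map.2 ⟨_, hmem, hu _ (by omega)⟩),
      zero_mul]
  have hpow : (π ^ (π.cycleOf a).support.card) a = a := by
    rw [← Perm.cycleOf_pow_apply_self, ← (Perm.isCycle_cycleOf π ha).orderOf, pow_orderOf_eq_one]
    rfl
  have h2 := Perm.two_le_of_mem_cycleType hmem
  interval_cases hk : (π.cycleOf a).support.card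
  · exact Or.inr (Or.inl hpow)
  · exact Or.inr (Or.inr hpow)

/-- Two sets of permutations agree in weight if they agree on the permutations with short
orbits. -/
theorem weightSum_congr_of_orbit {u : ℕ → R} (hu : ∀ k, 3 < k → u k = 0) {n : ℕ}
    {A B : Perm (Fin n) → Prop}
    (h : ∀ π : Perm (Fin n), (∀ a, π a = a ∨ π (π a) = a ∨ π (π (π a)) = a) → (A π ↔ B π)) :
    weightSum u n A = weightSum u n B := by
  classical
  refine Finset.sum_congr rfl fun π _ => ?_
  by_cases hw : cycleWeight u π = 0
  · simp [hw]
  · simp only [h π (orbit_of_cycleWeight_ne_zero hu hw)]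

/-- Two permutations `σ` and `τ` combine to one that acts as `σ` on the image of `f` and as `τ` on the
image of `g`, two images that partition `Fin n`. Its cycles are those of `σ` and of `τ`, so the
weight is multiplicative. -/
theorem exists_glue {a b n : ℕ} {f : Fin a → Fin n} {g : Fin b → Fin n}
    (hf : Function.Injective f) (hg : Function.Injective g) (hfg : ∀ i j, f i ≠ g j)
    (hn : a + b = n) (u : ℕ → R) (σ : Perm (Fin a)) (τ : Perm (Fin b)) :
    ∃ π : Perm (Fin n), (∀ i, π (f i) = f (σ i)) ∧ (∀ i, π (g i) = g (τ i)) ∧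
      cycleWeight u π = cycleWeight u σ * cycleWeight u τ := by
  classical
  set ef := Equiv.ofInjective f hf
  set eg := Equiv.ofInjective g hg
  have hf1 : ∀ i, σ.extendDomain ef (f i) = f (σ i) := fun i =>
    Perm.extendDomain_apply_image σ ef i
  have hg1 : ∀ i, τ.extendDomain eg (g i) = g (τ i) := fun i =>
    Perm.extendDomain_apply_image τ eg i
  have hf2 : ∀ x, (∀ i, f i ≠ x) → σ.extendDomain ef x = x := fun x hx =>
    Perm.extendDomain_apply_not_subtype σ ef fun ⟨i, hi⟩ => hx i hi
  have hg2 : ∀ x, (∀ i, g i ≠ x) → τ.extendDomain eg x = x := fun x hx =>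
    Perm.extendDomain_apply_not_subtype τ eg fun ⟨i, hi⟩ => hx i hi
  have hdisj : Perm.Disjoint (σ.extendDomain ef) (τ.extendDomain eg) := by
    intro x
    by_cases hx : ∃ i, f i = x
    · obtain ⟨i, rfl⟩ := hx
      exact Or.inr (hg2 _ fun j => (hfg i j).symm)
    · exact Or.inl (hf2 x fun i hi => hx ⟨i, hi⟩)
  refine ⟨σ.extendDomain ef * τ.extendDomain eg, fun i => ?_, fun i => ?_, ?_⟩
  · rw [Perm.mul_apply, hg2 _ fun j => (hfg i j).symm, hf1]
  · rw [Perm.mul_apply, hg1, hf2 _ fun j => hfg j _]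
  · rw [cycleWeight_eq, cycleWeight_eq, cycleWeight_eq, hdisj.cycleType_mul,
      Perm.cycleType_extendDomain, Perm.cycleType_extendDomain]
    have h1 := σ.sum_cycleType_le
    have h2 := τ.sum_cycleType_le
    rw [Fintype.card_fin] at h1 h2
    rw [Multiset.map_add, Multiset.prod_add, Multiset.sum_add,
      show n - (σ.cycleType.sum + τ.cycleType.sum)
        = (a - σ.cycleType.sum) + (b - τ.cycleType.sum) by omega, pow_add]
    ring

/-- A weighted sum over permutations that preserve the image of `f`, with a condition that decouples
along a partition of `Fin n` into the images of `f` and `g`, is a product. -/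
theorem weightSum_mul (u : ℕ → R) {a b n : ℕ} (f : Fin a → Fin n) (g : Fin b → Fin n)
    (hf : Function.Injective f) (hg : Function.Injective g) (hfg : ∀ i j, f i ≠ g j)
    (hn : a + b = n) {A : Perm (Fin n) → Prop} {B : Perm (Fin a) → Prop} {C : Perm (Fin b) → Prop}
    (hpres : ∀ π, A π → ∀ i, ∃ j, π (f i) = f j)
    (hA : ∀ π σ τ, (∀ i, π (f i) = f (σ i)) → (∀ i, π (g i) = g (τ i)) → (A π ↔ B σ ∧ C τ)) :
    weightSum u n A = weightSum u a B * weightSum u b C := by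
  classical
  have hcover : ∀ x, (∃ i, f i = x) ∨ ∃ j, g j = x := by
    have hbij : Function.Bijective (Sum.elim f g) := by
      rw [Fintype.bijective_iff_injective_and_card]
      exact ⟨Function.Injective.sumElim hf hg hfg, by simp [hn]⟩
    intro x
    obtain ⟨i | j, rfl⟩ := hbij.2 x
    · exact Or.inl ⟨i, rfl⟩
    · exact Or.inr ⟨j, rfl⟩
  choose P hP1 hP2 hP3 using fun s : Perm (Fin a) × Perm (Fin b) =>
    exists_glue hf hg hfg hn u s.1 s.2
  rw [weightSum, weightSum, weightSum, Finset.sum_mul_sum, ← Finset.sum_product',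
    Finset.univ_product_univ, ← Finset.sum_filter]
  have hrhs : ∀ s : Perm (Fin a) × Perm (Fin b),
      ((if B s.1 then cycleWeight u s.1 else 0) * if C s.2 then cycleWeight u s.2 else 0) =
        if A (P s) then cycleWeight u (P s) else 0 := by
    intro s
    rw [hP3, if_congr (hA _ _ _ (hP1 s) (hP2 s)) rfl rfl]
    by_cases h1 : B s.1 <;> by_cases h2 : C s.2 <;> simp [h1, h2]
  rw [Finset.sum_congr rfl fun s _ => hrhs s, ← Finset.sum_filter]
  symm
  refine Finset.sum_bij (fun s _ => P s) (fun s hs => by simpa using hs) ?_ ?_ fun _ _ => rfl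
  · rintro s - s' - h
    refine Prod.ext (Equiv.ext fun i => hf ?_) (Equiv.ext fun i => hg ?_)
    · rw [← hP1 s, ← hP1 s', h]
    · rw [← hP2 s, ← hP2 s', h]
  · intro π hπ
    replace hπ : A π := by simpa using hπ
    choose s hs using hpres π hπ
    have hs_inj : Function.Injective s := fun i j hij => by
      apply hf
      apply π.injective
      rw [hs, hs, hij]
    have hs_bij := Finite.injective_iff_bijective.1 hs_inj
    have hpres' : ∀ i, ∃ j, π (g i) = g j := by
      intro i
      rcases hcover (π (g i)) with ⟨k, hk⟩ | ⟨j, hj⟩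
      · obtain ⟨k', rfl⟩ := hs_bij.2 k
        rw [← hs] at hk
        exact absurd (π.injective hk) (hfg _ _)
      · exact ⟨j, hj.symm⟩
    choose t ht using hpres'
    have ht_inj : Function.Injective t := fun i j hij => by
      apply hg
      apply π.injective
      rw [ht, ht, hij]
    have ht_bij := Finite.injective_iff_bijective.1 ht_inj
    have hP : P (Equiv.ofBijective s hs_bij, Equiv.ofBijective t ht_bij) = π := by
      ext x : 1
      rcases hcover x with ⟨i, rfl⟩ | ⟨i, rfl⟩
      · rw [hP1, hs]; rfl
      · rw [hP2, ht]; rfl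
    exact ⟨(Equiv.ofBijective s hs_bij, Equiv.ofBijective t ht_bij), by simpa [hP] using hπ, hP⟩

end Weights

/-! ### Avoiders and their recursive structure -/

section Structure

variable {n : ℕ}

/-- Avoidance of `231`, spelled out on triples of positions. -/
def Avoids231 (π : Perm (Fin n)) : Prop :=
  ∀ a b c : Fin n, a < b → b < c → π c < π a → π a < π b → False

/-- `π` is the decreasing permutation. -/
def IsDecreasing (π : Perm (Fin n)) : Prop := ∀ a b : Fin n, a < b → π b < π a

/-- A `231`-avoider that begins with its largest letter; these are the avoiders which are not the
direct sum of two smaller permutations. -/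
def IsTop (π : Perm (Fin n)) : Prop :=
  Avoids231 π ∧ ∃ i : Fin n, i.val = 0 ∧ (π i).val + 1 = n

/-- A `231`-avoider with the `3`-cycle first `→` last `→ j →` first, where position `j` is neither
the first nor the last. -/
def HasOuterCycle (j : ℕ) (π : Perm (Fin n)) : Prop :=
  Avoids231 π ∧ 0 < j ∧ j + 1 < n ∧ ∃ i l m : Fin n, i.val = 0 ∧ l.val + 1 = n ∧ m.val = j ∧
    π i = l ∧ π l = m ∧ π m = i

/-- A `231`-avoider that is decreasing on the positions below `s`, and in which the values from `s`
on appear in decreasing order. These are the permutations around which an outer `3`-cycle can be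
wrapped, with its middle position inserted at the cut `s`, without creating a `231`. -/
def IsDoublyDecreasing (s : ℕ) (π : Perm (Fin n)) : Prop :=
  Avoids231 π ∧ (∀ a b : Fin n, a < b → b.val < s → π b < π a) ∧
    ∀ a b : Fin n, a < b → s ≤ (π a).val → s ≤ (π b).val → π b < π a

theorem Avoids231.restrict {m : ℕ} {f : Fin m → Fin n} (hf : StrictMono f) {π : Perm (Fin n)}
    {σ : Perm (Fin m)} (h : ∀ i, π (f i) = f (σ i)) (hπ : Avoids231 π) : Avoids231 σ := by
  intro a b c hab hbc hca hab'
  refine hπ (f a) (f b) (f c) (hf hab) (hf hbc) ?_ ?_ <;> rw [h, h]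
  · exact hf hca
  · exact hf hab'

theorem IsDecreasing.avoids {π : Perm (Fin n)} (h : IsDecreasing π) : Avoids231 π :=
  fun a b _ hab _ _ hab' => lt_asymm hab' (h a b hab)

theorem IsDecreasing.first {π : Perm (Fin n)} (h : IsDecreasing π) {i l : Fin n}
    (hi : i.val = 0) (hl : l.val + 1 = n) : π i = l := by
  obtain ⟨x, rfl⟩ := π.surjective l
  by_contra hne
  have hx : i < x := by
    rcases lt_trichotomy i x with hx | rfl | hx
    · exact hx
    · exact absurd rfl hne
    · rw [Fin.lt_def] at hx; omega
  have := h i x hx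
  rw [Fin.lt_def] at this
  omega

theorem IsDecreasing.last {π : Perm (Fin n)} (h : IsDecreasing π) {i l : Fin n}
    (hi : i.val = 0) (hl : l.val + 1 = n) : π l = i := by
  obtain ⟨x, rfl⟩ := π.surjective i
  by_contra hne
  have hx : x < l := by
    rcases lt_trichotomy x l with hx | rfl | hx
    · exact hx
    · exact absurd rfl hne
    · rw [Fin.lt_def] at hx; omega
  have := h x l hx
  rw [Fin.lt_def] at this
  omega

/-- In a `231`-avoider the positions before the largest letter carry the smallest values. -/
theorem Avoids231.lt_of_lt_max {π : Perm (Fin n)} (h : Avoids231 π) {a x : Fin n}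
    (ha : (π a).val + 1 = n) (hx : x < a) : π x < a := by
  by_contra hlt
  push Not at hlt
  have hxa : π x < π a := by
    have hne : π x ≠ π a := fun e => hx.ne (π.injective e)
    rw [← Fin.val_ne_iff] at hne
    rw [Fin.lt_def]
    omega
  have hsub : (Finset.Ici a).image π ⊆ Finset.Ioi (π x) := by
    intro y hy
    obtain ⟨y, hy', rfl⟩ := Finset.mem_image.1 hy
    clear hy
    rw [Finset.mem_Ici] at hy'
    rw [Finset.mem_Ioi]
    rcases hy'.eq_or_lt with rfl | hay
    · exact hxa
    · by_contra hle
      have hne : π x ≠ π y := fun e => (hx.trans hay).ne (π.injective e)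
      exact h x a y hx hay (lt_of_le_of_ne (not_lt.1 hle) hne.symm) hxa
  have hcard := Finset.card_le_card hsub
  rw [Finset.card_image_of_injective _ π.injective, Fin.card_Ici, Fin.card_Ioi] at hcard
  rw [Fin.le_def] at hlt
  omega

/-- An avoider whose first letter is the largest and whose last letter is the smallest is
decreasing: the last letter completes every ascent to a `231`. -/
theorem Avoids231.isDecreasing {π : Perm (Fin n)} (h : Avoids231 π) {i l : Fin n}
    (hi : i.val = 0) (hl : l.val + 1 = n) (hli : π l = i) : IsDecreasing π := by
  have hpos : ∀ x, x ≠ l → π l < π x := by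
    intro x hx
    have hne : π x ≠ π l := fun e => hx (π.injective e)
    rw [← Fin.val_ne_iff, hli] at hne
    rw [Fin.lt_def, hli]
    omega
  intro a b hab
  have hal : a ≠ l := by rw [← Fin.val_ne_iff]; rw [Fin.lt_def] at hab; omega
  by_cases hbl : b = l
  · rw [hbl]; exact hpos a hal
  · have hbl' : b < l := by rw [Fin.ext_iff] at hbl; rw [Fin.lt_def]; omega
    by_contra hle
    have hne : π a ≠ π b := fun e => hab.ne (π.injective e)
    exact h a b l hab hbl' (hpos a hal) (lt_of_le_of_ne (not_lt.1 hle) hne)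

/-- If all orbits have length at most `3`, an avoider beginning with its largest letter is
decreasing or has an outer `3`-cycle. -/
theorem Avoids231.decreasing_or_outerCycle {π : Perm (Fin n)} (h : Avoids231 π) {i l : Fin n}
    (hi : i.val = 0) (hl : l.val + 1 = n) (hil : π i = l)
    (horb : ∀ a, π a = a ∨ π (π a) = a ∨ π (π (π a)) = a) :
    IsDecreasing π ∨ ∃ j < n, HasOuterCycle j π := by
  rcases horb i with h1 | h1 | h1
  · left
    intro a b hab
    rw [← h1, hil] at hi
    rw [Fin.lt_def] at hab
    omega
  · exact Or.inl (h.isDecreasing hi hl (by rw [← hil]; exact h1))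
  · by_cases hli : π l = i
    · exact Or.inl (h.isDecreasing hi hl hli)
    right
    have hne1 : (π l).val ≠ i.val := fun e => hli (Fin.ext e)
    have hne2 : (π l).val ≠ l.val := fun e => by
      have e' : π l = l := Fin.ext e
      have : l = i := π.injective (by rw [e', hil])
      exact hli (by rw [e', this])
    refine ⟨(π l).val, (π l).isLt, h, by omega, by omega, i, l, π l, hi, hl, rfl, hil, rfl, ?_⟩
    rw [← hil]
    exact h1

theorem HasOuterCycle.unique {π : Perm (Fin n)} {j k : ℕ} (hj : HasOuterCycle j π)
    (hk : HasOuterCycle k π) : j = k := by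
  obtain ⟨-, -, -, i, l, m, hi, hl, hm, h1, h2, h3⟩ := hj
  obtain ⟨-, -, -, i', l', m', hi', hl', hm', h1', h2', h3'⟩ := hk
  have : l = l' := Fin.ext (by omega)
  subst this
  rw [h2] at h2'
  rw [← hm, ← hm', h2']

theorem HasOuterCycle.not_isDecreasing {π : Perm (Fin n)} {j : ℕ} (hj : HasOuterCycle j π) :
    ¬ IsDecreasing π := by
  obtain ⟨-, h0, -, i, l, m, hi, hl, hm, h1, h2, h3⟩ := hj
  intro h
  have := h.last hi hl
  rw [h2] at this
  rw [this] at hm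
  omega

theorem isTop_iff (hn : 0 < n) {π : Perm (Fin n)}
    (horb : ∀ a, π a = a ∨ π (π a) = a ∨ π (π (π a)) = a) :
    IsTop π ↔ IsDecreasing π ∨ ∃ j < n, HasOuterCycle j π := by
  constructor
  · rintro ⟨h, i, hi, hl⟩
    exact h.decreasing_or_outerCycle hi hl rfl horb
  · rintro (h | ⟨j, -, h, -, -, i, l, m, hi, hl, -, hil, -⟩)
    · refine ⟨h.avoids, ⟨0, hn⟩, rfl, ?_⟩
      rw [h.first (i := ⟨0, hn⟩) (l := ⟨n - 1, by omega⟩) rfl (by simp; omega)]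
      simp; omega
    · exact ⟨h, i, hi, by rw [hil]; exact hl⟩

/-- With an outer `3`-cycle through the middle position `j`, both cuts next to `j` are admissible:
an ascent on the wrong side would form a `231` with the letter `0` at position `j`, or with the
letter `j` at the last position. -/
theorem HasOuterCycle.isDoublyDecreasing {π : Perm (Fin n)} {j s : ℕ} (hj : HasOuterCycle j π)
    (h1 : j ≤ s) (h2 : s ≤ j + 1) : IsDoublyDecreasing s π := by
  obtain ⟨h, -, -, i, l, m, hi, hl, hm, hil, hlm, hmi⟩ := hj
  refine ⟨h, fun a b hab hb => ?_, fun a b hab ha hb => ?_⟩ <;> by_contra hle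
  all_goals
    have hne : π a ≠ π b := fun e => hab.ne (π.injective e)
    have hlt : π a < π b := lt_of_le_of_ne (not_lt.1 hle) hne
  · have ham : π a ≠ π m := by
      intro e
      have := π.injective e
      rw [Fin.lt_def] at hab
      subst this
      omega
    by_cases hbm : b = m
    · rw [hbm, hmi, Fin.lt_def] at hlt
      omega
    · rw [Fin.ext_iff] at hbm
      rw [← Fin.val_ne_iff, hmi] at ham
      exact h a b m hab (by rw [Fin.lt_def]; omega) (by rw [Fin.lt_def, hmi]; omega) hlt
  · by_cases hbl : b = l
    · rw [hbl, hlm, Fin.lt_def] at hlt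
      omega
    · have hal : π a ≠ π l := by
        intro e
        have := π.injective e
        rw [Fin.lt_def] at hab
        subst this
        omega
      rw [Fin.ext_iff] at hbl
      rw [← Fin.val_ne_iff, hlm] at hal
      exact h a b l hab (by rw [Fin.lt_def]; omega) (by rw [Fin.lt_def, hlm]; omega) hlt

/-- The doubly decreasing permutations that mix the two sides of the cut: the decreasing one, and
those with an outer `3`-cycle whose middle position is `s` or `s - 1`. -/
theorem isDoublyDecreasing_and_not_preserves_iff {s : ℕ} (hs : 0 < s) (hsn : s < n)
    {π : Perm (Fin n)} (horb : ∀ a, π a = a ∨ π (π a) = a ∨ π (π (π a)) = a) :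
    (IsDoublyDecreasing s π ∧ ¬ ∀ i : Fin n, i.val < s → (π i).val < s) ↔
      IsDecreasing π ∨ HasOuterCycle s π ∨ HasOuterCycle (s - 1) π := by
  constructor
  · rintro ⟨⟨h, hpos, hval⟩, hmix⟩
    push Not at hmix
    obtain ⟨k, hk, hks⟩ := hmix
    set i : Fin n := ⟨0, by omega⟩ with hi
    set l : Fin n := ⟨n - 1, by omega⟩ with hl
    have hi0 : i.val = 0 := rfl
    have hl0 : l.val + 1 = n := by simp [hl]; omega
    have his : s ≤ (π i).val := by
      by_cases hki : k = i
      · rw [← hki]; exact hks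
      · rw [Fin.ext_iff] at hki
        have := hpos i k (by rw [Fin.lt_def]; omega) hk
        rw [Fin.lt_def] at this
        omega
    have hil : π i = l := by
      obtain ⟨x, hx⟩ := π.surjective l
      by_cases hxi : x = i
      · rw [← hxi, hx]
      · rw [Fin.ext_iff] at hxi
        have := hval i x (by rw [Fin.lt_def]; omega) his (by rw [hx]; omega)
        rw [Fin.lt_def, hx] at this
        omega
    rcases h.decreasing_or_outerCycle hi0 hl0 hil horb with hd | ⟨j, hjn, hj⟩
    · exact Or.inl hd
    right
    have hj' := hj
    obtain ⟨-, hj0, -, i', l', m, hi', hl', hm, -, hlm, hmi⟩ := hj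
    by_cases hjs : j < s
    · -- `0` sits at position `j`, hence at the last position before the cut.
      right
      have : j = s - 1 := by
        by_contra hne
        have := hpos m ⟨s - 1, by omega⟩ (by rw [Fin.lt_def]; simp only; omega)
          (by simp only; omega)
        rw [hmi, Fin.lt_def] at this
        omega
      rwa [← this]
    · -- `j` sits at the last position, hence is the smallest value after the cut.
      left
      have : j = s := by
        by_contra hne
        obtain ⟨y, hy⟩ := π.surjective ⟨s, hsn⟩
        have hyl : y ≠ l' := by
          rintro rfl
          rw [hy] at hlm
          rw [← hlm] at hm
          exact hne hm.symm
        rw [← Fin.val_ne_iff] at hyl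
        have := hval y l' (by rw [Fin.lt_def]; omega) (by rw [hy]) (by rw [hlm]; omega)
        rw [hy, hlm, Fin.lt_def] at this
        simp only at this
        omega
      rwa [← this]
  · rintro (h | h)
    · refine ⟨⟨h.avoids, fun a b hab _ => h a b hab, fun a b hab _ _ => h a b hab⟩, fun hp => ?_⟩
      have := hp ⟨0, by omega⟩ hs
      rw [h.first (i := ⟨0, by omega⟩) (l := ⟨n - 1, by omega⟩) rfl (by simp; omega)] at this
      simp only at this
      omega
    · have key : ∃ j, HasOuterCycle j π ∧ j ≤ s ∧ s ≤ j + 1 := by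
        rcases h with h | h
        · exact ⟨s, h, by omega, by omega⟩
        · exact ⟨s - 1, h, by omega, by omega⟩
      obtain ⟨j, hj, h1, h2⟩ := key
      refine ⟨hj.isDoublyDecreasing h1 h2, fun hp => ?_⟩
      obtain ⟨-, -, -, i, l, m, hi, hl, -, hil, -⟩ := hj
      have := hp i (by omega)
      rw [hil] at this
      omega

end Structure

/-! ### Recurrences for the weighted sums -/

section Recurrences

variable {R : Type*} [CommRing R]

/-- The embedding of `Fin b` onto the positions from `a` on. -/
def upperEmb {a b n : ℕ} (h : a + b = n) (i : Fin b) : Fin n := ⟨a + i.val, by omega⟩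

theorem upperEmb_strictMono {a b n : ℕ} (h : a + b = n) : StrictMono (upperEmb h) :=
  fun i j hij => by
    rw [Fin.lt_def] at hij ⊢
    simp only [upperEmb]
    omega

/-- A direct sum avoids `231` if and only if both summands do. -/
theorem avoids_iff_of_directSum {a b n : ℕ} (h : a + b = n) {π : Perm (Fin n)} {σ : Perm (Fin a)}
    {τ : Perm (Fin b)} (hσ : ∀ i, π (Fin.castLE (by omega) i) = Fin.castLE (by omega) (σ i))
    (hτ : ∀ i, π (upperEmb h i) = upperEmb h (τ i)) :
    Avoids231 π ↔ Avoids231 σ ∧ Avoids231 τ := by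
  have han : a ≤ n := by omega
  have hmono : StrictMono (Fin.castLE han) := Fin.strictMono_castLE _
  refine ⟨fun hπ => ⟨hπ.restrict hmono hσ,
    hπ.restrict (upperEmb_strictMono h) hτ⟩, fun ⟨h1, h2⟩ x y z hxy hyz hzx hxy' => ?_⟩
  have hlow : ∀ x : Fin n, x.val < a → ∃ i : Fin a, Fin.castLE han i = x := fun x hx =>
    ⟨⟨x.val, hx⟩, rfl⟩
  have hupp : ∀ x : Fin n, a ≤ x.val → ∃ i, upperEmb h i = x := fun x hx =>
    ⟨⟨x.val - a, by omega⟩, Fin.ext (by simp only [upperEmb]; omega)⟩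
  rw [Fin.lt_def] at hxy hyz
  by_cases hz : z.val < a
  · obtain ⟨x, rfl⟩ := hlow x (by omega)
    obtain ⟨y, rfl⟩ := hlow y (by omega)
    obtain ⟨z, rfl⟩ := hlow z hz
    rw [hσ, hσ, hmono.lt_iff_lt] at hzx hxy'
    exact h1 x y z hxy hyz hzx hxy'
  by_cases hx : x.val < a
  · obtain ⟨x, rfl⟩ := hlow x hx
    obtain ⟨z, rfl⟩ := hupp z (by omega)
    rw [hσ, hτ, Fin.lt_def] at hzx
    simp only [upperEmb, Fin.val_castLE] at hzx
    have := (σ x).isLt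
    omega
  · obtain ⟨x, rfl⟩ := hupp x (by omega)
    obtain ⟨y, rfl⟩ := hupp y (by omega)
    obtain ⟨z, rfl⟩ := hupp z (by omega)
    rw [hτ, hτ, (upperEmb_strictMono h).lt_iff_lt] at hzx hxy'
    refine h2 x y z ?_ ?_ hzx hxy' <;> rw [← (upperEmb_strictMono h).lt_iff_lt] <;> assumption

theorem castLE_ne_upperEmb {a b n : ℕ} (h : a + b = n) (i : Fin a) (j : Fin b) :
    Fin.castLE (by omega) i ≠ upperEmb h j := by
  rw [← Fin.val_ne_iff]
  simp only [upperEmb, Fin.val_castLE]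
  omega

/-- Splitting an avoider at its largest letter. -/
theorem weightSum_avoids (u : ℕ → R) {n : ℕ} (hn : 0 < n) :
    weightSum u n Avoids231 =
      ∑ a ∈ Finset.range n, weightSum u a Avoids231 * weightSum u (n - a) IsTop := by
  rw [weightSum_exists u (m := n)
    (B := fun a π => Avoids231 π ∧ ∃ i : Fin n, i.val = a ∧ (π i).val + 1 = n)]
  · refine Finset.sum_congr rfl fun a ha => ?_
    rw [Finset.mem_range] at ha
    have hsum : a + (n - a) = n := by omega
    refine weightSum_mul u (Fin.castLE (by omega)) (upperEmb hsum)
      (Fin.strictMono_castLE _).injective (upperEmb_strictMono hsum).injective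
      (castLE_ne_upperEmb hsum) hsum ?_ ?_
    · rintro π ⟨hπ, x, rfl, hx⟩ i
      exact ⟨⟨_, hπ.lt_of_lt_max hx (x := Fin.castLE (by omega) i) i.isLt⟩, rfl⟩
    · intro π σ τ hσ hτ
      rw [avoids_iff_of_directSum hsum hσ hτ, IsTop, and_assoc]
      refine and_congr_right fun _ => and_congr_right fun _ => ⟨?_, ?_⟩
      · rintro ⟨i, hi, hm⟩
        refine ⟨⟨0, by omega⟩, rfl, ?_⟩
        have : i = upperEmb hsum ⟨0, by omega⟩ := Fin.ext (by simp [upperEmb, hi])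
        rw [this, hτ] at hm
        simp only [upperEmb] at hm
        omega
      · rintro ⟨i, hi, hm⟩
        refine ⟨upperEmb hsum i, by simp [upperEmb, hi], ?_⟩
        rw [hτ]
        simp only [upperEmb]
        omega
  · refine fun π => ⟨fun hπ => ?_, fun ⟨_, _, hπ, _⟩ => hπ⟩
    obtain ⟨i, hi⟩ := π.surjective ⟨n - 1, by omega⟩
    exact ⟨i.val, i.isLt, hπ, i, rfl, by rw [hi]; simp only; omega⟩
  · rintro π a b ⟨-, i, rfl, hi⟩ ⟨-, j, rfl, hj⟩
    rw [π.injective (Fin.ext (by omega) : π i = π j)]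

theorem weightSum_isTop {u : ℕ → R} (hu : ∀ k, 3 < k → u k = 0) {n : ℕ} (hn : 0 < n) :
    weightSum u n IsTop = weightSum u n IsDecreasing +
      ∑ j ∈ Finset.range n, weightSum u n (HasOuterCycle j) := by
  rw [weightSum_congr_of_orbit hu fun π horb => isTop_iff hn horb,
    weightSum_or u (fun π => Iff.rfl) fun π hd ⟨j, _, hj⟩ => hj.not_isDecreasing hd]
  congr 1
  exact weightSum_exists u (fun π => Iff.rfl) fun π i j hi hj => hi.unique hj

/-- The doubly decreasing permutations that preserve the cut are the direct sums of two decreasing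
permutations. -/
theorem weightSum_isDoublyDecreasing_and_preserves (u : ℕ → R) {n s : ℕ} (hs : s ≤ n) :
    weightSum u n (fun π => IsDoublyDecreasing s π ∧ ∀ i : Fin n, i.val < s → (π i).val < s) =
      weightSum u s IsDecreasing * weightSum u (n - s) IsDecreasing := by
  have hsum : s + (n - s) = n := by omega
  have hmono : StrictMono (Fin.castLE hs) := Fin.strictMono_castLE _
  refine weightSum_mul u (Fin.castLE hs) (upperEmb hsum) hmono.injective
    (upperEmb_strictMono hsum).injective (castLE_ne_upperEmb hsum) hsum ?_ ?_
  · rintro π ⟨-, hπ⟩ i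
    exact ⟨⟨_, hπ (Fin.castLE hs i) i.isLt⟩, rfl⟩
  · intro π σ τ hσ hτ
    have hlow : ∀ x : Fin n, x.val < s → ∃ i : Fin s, Fin.castLE hs i = x := fun x hx =>
      ⟨⟨x.val, hx⟩, rfl⟩
    have hupp : ∀ x : Fin n, s ≤ x.val → ∃ i, upperEmb hsum i = x := fun x hx =>
      ⟨⟨x.val - s, by omega⟩, Fin.ext (by simp only [upperEmb]; omega)⟩
    rw [IsDoublyDecreasing, avoids_iff_of_directSum hsum hσ hτ]
    constructor
    · rintro ⟨⟨-, h1, h2⟩, -⟩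
      refine ⟨fun a b hab => ?_, fun a b hab => ?_⟩
      · have := h1 _ _ (hmono hab) b.isLt
        rwa [hσ, hσ, hmono.lt_iff_lt] at this
      · have := h2 _ _ (upperEmb_strictMono hsum hab) (by rw [hτ]; simp [upperEmb])
          (by rw [hτ]; simp [upperEmb])
        rwa [hτ, hτ, (upperEmb_strictMono hsum).lt_iff_lt] at this
    · rintro ⟨h1, h2⟩
      have hpres : ∀ i : Fin n, i.val < s → (π i).val < s := by
        intro x hx
        obtain ⟨x, rfl⟩ := hlow x hx
        rw [hσ]
        exact (σ x).isLt
      refine ⟨⟨⟨h1.avoids, h2.avoids⟩, fun a b hab hb => ?_, fun a b hab ha hb => ?_⟩, hpres⟩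
      · rw [Fin.lt_def] at hab
        obtain ⟨a, rfl⟩ := hlow a (by omega)
        obtain ⟨b, rfl⟩ := hlow b hb
        rw [hσ, hσ, hmono.lt_iff_lt]
        exact h1 a b hab
      · have ha' := hpres a
        have hb' := hpres b
        obtain ⟨a, rfl⟩ := hupp a (by omega)
        obtain ⟨b, rfl⟩ := hupp b (by omega)
        rw [hτ, hτ, (upperEmb_strictMono hsum).lt_iff_lt]
        exact h2 a b ((upperEmb_strictMono hsum).lt_iff_lt.1 hab)

theorem weightSum_hasOuterCycle_eq_zero (u : ℕ → R) {n j : ℕ} (h : j = 0 ∨ n ≤ j + 1) :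
    weightSum u n (HasOuterCycle j) = 0 :=
  weightSum_eq_zero u fun _ ⟨_, h1, h2, _⟩ => by omega

/-- Classification of the doubly decreasing permutations at a cut `s`. At the extreme cuts the last
three terms are absent: the last two vanish by the bounds on `j` in `HasOuterCycle`. -/
theorem weightSum_isDoublyDecreasing {u : ℕ → R} (hu : ∀ k, 3 < k → u k = 0) {n s : ℕ}
    (hs : s ≤ n) :
    weightSum u n (IsDoublyDecreasing s) =
      weightSum u s IsDecreasing * weightSum u (n - s) IsDecreasing +
        ((if 0 < s ∧ s < n then weightSum u n IsDecreasing else 0) +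
          (weightSum u n (HasOuterCycle s) + weightSum u n (HasOuterCycle (s - 1)))) := by
  rw [weightSum_or u (A := IsDoublyDecreasing s)
    (B := fun π => IsDoublyDecreasing s π ∧ ∀ i : Fin n, i.val < s → (π i).val < s)
    (C := fun π => IsDoublyDecreasing s π ∧ ¬ ∀ i : Fin n, i.val < s → (π i).val < s)
    (fun π => by tauto) (fun π => by tauto), weightSum_isDoublyDecreasing_and_preserves u hs]
  congr 1
  split_ifs with h
  · rw [weightSum_congr_of_orbit hu fun π horb =>
        isDoublyDecreasing_and_not_preserves_iff h.1 h.2 horb,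
      weightSum_or u (fun π => Iff.rfl)
        fun π hd hj => hj.elim (·.not_isDecreasing hd) (·.not_isDecreasing hd),
      weightSum_or u (B := HasOuterCycle s) (fun π => Iff.rfl)
        fun π h1 h2 => by have := h1.unique h2; omega]
  · rw [weightSum_hasOuterCycle_eq_zero u (by omega), weightSum_hasOuterCycle_eq_zero u (by omega),
      add_zero, add_zero]
    refine weightSum_eq_zero u ?_
    rintro π ⟨-, hp⟩
    exact hp fun i hi => by have := (π i).isLt; omega

theorem weightSum_isDecreasing_zero (u : ℕ → R) : weightSum u 0 IsDecreasing = 1 := by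
  rw [weightSum_eq_of_unique u 1
    fun π => ⟨fun _ => Subsingleton.elim _ _, fun _ a => a.elim0⟩, cycleWeight_eq]
  simp

theorem weightSum_isDecreasing_one (u : ℕ → R) : weightSum u 1 IsDecreasing = u 1 := by
  rw [weightSum_eq_of_unique u 1 fun π => ⟨fun _ => Subsingleton.elim _ _, fun _ a b hab =>
    absurd (Subsingleton.elim a b) hab.ne⟩, cycleWeight_eq]
  simp

theorem weightSum_isDecreasing_two (u : ℕ → R) : weightSum u 2 IsDecreasing = u 2 := by
  rw [weightSum_eq_of_unique u (swap 0 1) (by unfold IsDecreasing; decide), cycleWeight_eq,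
    Perm.isSwap_iff_cycleType.1 ⟨0, 1, by decide, rfl⟩]
  simp

/-- Removing the outer `2`-cycle of a decreasing permutation. -/
theorem weightSum_isDecreasing_add_two (u : ℕ → R) (n : ℕ) :
    weightSum u (n + 2) IsDecreasing = u 2 * weightSum u n IsDecreasing := by
  rw [← weightSum_isDecreasing_two u]
  have hf : StrictMono (![0, Fin.last (n + 1)] : Fin 2 → Fin (n + 2)) := by
    intro i j hij
    fin_cases i <;> fin_cases j <;> simp_all [Fin.lt_def]
  have hg : StrictMono (fun i : Fin n => i.succ.castSucc) := fun i j hij => by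
    simpa using hij
  refine weightSum_mul u ![0, Fin.last (n + 1)] (fun i : Fin n => i.succ.castSucc)
    hf.injective hg.injective ?_ (by omega) ?_ ?_
  · intro i j
    rw [← Fin.val_ne_iff]
    fin_cases i
    · simp
    · simp; omega
  · intro π hπ i
    fin_cases i
    · exact ⟨1, hπ.first rfl rfl⟩
    · exact ⟨0, hπ.last rfl rfl⟩
  · intro π σ τ hσ hτ
    constructor
    · refine fun h => ⟨fun a b hab => ?_, fun a b hab => ?_⟩
      · have := h _ _ (hf hab)
        rwa [hσ, hσ, hf.lt_iff_lt] at this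
      · have := h _ _ (hg hab)
        rwa [hτ, hτ, hg.lt_iff_lt] at this
    · rintro ⟨h1, h2⟩
      have h0 : π 0 = Fin.last (n + 1) := by
        have := hσ 0
        rwa [h1.first (i := 0) (l := 1) rfl rfl] at this
      have hl : π (Fin.last (n + 1)) = 0 := by
        have := hσ 1
        rwa [h1.last (i := 0) (l := 1) rfl rfl] at this
      intro a b hab
      have hmid : ∀ x : Fin (n + 2), x ≠ 0 → x ≠ Fin.last (n + 1) →
          ∃ i : Fin n, i.succ.castSucc = x := by
        intro x hx hx'
        rw [← Fin.val_ne_iff] at hx hx'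
        simp only [Fin.val_zero, Fin.val_last] at hx hx'
        exact ⟨⟨x.val - 1, by omega⟩, Fin.ext (by simp; omega)⟩
      by_cases ha : a = 0
      · subst ha
        have hne : π b ≠ π 0 := fun e => hab.ne' (π.injective e)
        rw [h0] at hne ⊢
        exact Fin.lt_last_iff_ne_last.2 hne
      by_cases hb : b = Fin.last (n + 1)
      · subst hb
        have hne : π a ≠ π (Fin.last (n + 1)) := fun e => hab.ne (π.injective e)
        rw [hl] at hne ⊢
        exact Fin.pos_iff_ne_zero.2 hne
      obtain ⟨a, rfl⟩ := hmid a ha (hab.trans_le (Fin.le_last b)).ne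
      obtain ⟨b, rfl⟩ := hmid b ((Fin.zero_le _).trans_lt hab).ne' hb
      rw [hτ, hτ, hg.lt_iff_lt]
      exact h2 a b (hg.lt_iff_lt.1 hab)

/-- The `3`-cycle first `→` last `→` middle `→` first on three letters. -/
theorem weightSum_threeCycle (u : ℕ → R) :
    weightSum u 3 (fun σ => σ 0 = 2 ∧ σ 2 = 1 ∧ σ 1 = 0) = u 3 := by
  rw [weightSum_eq_of_unique u p231⁻¹ (by decide), cycleWeight_eq,
    show (p231⁻¹ : Perm (Fin 3)).cycleType = {3} from
      card_support_eq_three_iff.1 (by decide)]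
  simp

/-- The embedding of `Fin n` into `Fin (n + 3)` that avoids the first, the last and the position
`j + 1`. -/
def middleEmb {n : ℕ} (j : ℕ) (i : Fin n) : Fin (n + 3) :=
  ⟨if i.val < j then i.val + 1 else i.val + 2, by split_ifs <;> omega⟩

theorem middleEmb_strictMono {n : ℕ} (j : ℕ) : StrictMono (middleEmb (n := n) j) :=
  fun a b hab => by
    rw [Fin.lt_def] at hab ⊢
    simp only [middleEmb]
    split_ifs <;> omega

/-- Removing the outer `3`-cycle leaves a doubly decreasing permutation. -/
theorem weightSum_hasOuterCycle (u : ℕ → R) {n j : ℕ} (hj : j ≤ n) :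
    weightSum u (n + 3) (HasOuterCycle (j + 1)) = u 3 * weightSum u n (IsDoublyDecreasing j) := by
  rw [← weightSum_threeCycle u]
  set m : Fin (n + 3) := ⟨j + 1, by omega⟩ with hm
  set l : Fin (n + 3) := Fin.last (n + 2) with hl
  have hf : StrictMono (![0, m, l] : Fin 3 → Fin (n + 3)) := by
    intro a b hab
    fin_cases a <;> fin_cases b <;> simp_all [Fin.lt_def]
  have hg := middleEmb_strictMono (n := n) j
  have hlt : ∀ i : Fin n, middleEmb j i < m ↔ i.val < j := fun i => by
    rw [Fin.lt_def]
    simp only [middleEmb, hm]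
    split_ifs <;> omega
  have hgt : ∀ i : Fin n, m < middleEmb j i ↔ j ≤ i.val := fun i => by
    rw [Fin.lt_def]
    simp only [middleEmb, hm]
    split_ifs <;> omega
  have hpos : ∀ i : Fin n, 0 < middleEmb j i := fun i => by
    rw [Fin.lt_def]
    simp only [middleEmb, Fin.val_zero]
    split_ifs <;> omega
  have hlast : ∀ i : Fin n, middleEmb j i < l := fun i => by
    rw [Fin.lt_def]
    simp only [middleEmb, hl, Fin.val_last]
    split_ifs <;> omega
  have hmid : ∀ x : Fin (n + 3), x ≠ 0 → x ≠ m → x ≠ l → ∃ i, middleEmb j i = x := by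
    intro x h0 h1 h2
    rw [← Fin.val_ne_iff] at h0 h1 h2
    simp only [Fin.val_zero, hm, hl, Fin.val_last] at h0 h1 h2
    rcases lt_or_ge x.val (j + 1) with hx | hx
    · refine ⟨⟨x.val - 1, by omega⟩, Fin.ext ?_⟩
      simp only [middleEmb]
      split_ifs <;> omega
    · refine ⟨⟨x.val - 2, by omega⟩, Fin.ext ?_⟩
      simp only [middleEmb]
      split_ifs <;> omega
  refine weightSum_mul u ![0, m, l] (middleEmb j) hf.injective hg.injective ?_ (by omega) ?_ ?_
  · intro a b
    fin_cases a
    · exact (hpos b).ne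
    · intro e
      have e' : m = middleEmb j b := e
      have h1 := hlt b
      have h2 := hgt b
      rw [← e'] at h1 h2
      simp only [lt_irrefl, false_iff] at h1 h2
      omega
    · exact (hlast b).ne'
  · rintro π ⟨-, -, -, i, l', m', hi, hl', hm', h1, h2, h3⟩ a
    have ei : i = 0 := Fin.ext hi
    have el : l' = l := Fin.ext (by simp only [hl, Fin.val_last]; omega)
    have em : m' = m := Fin.ext hm'
    rw [ei, el] at h1
    rw [el, em] at h2
    rw [em, ei] at h3
    fin_cases a
    · exact ⟨2, h1⟩
    · exact ⟨0, h3⟩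
    · exact ⟨1, h2⟩
  · intro π σ τ hσ hτ
    have hσ0 : π 0 = ![0, m, l] (σ 0) := hσ 0
    have hσ1 : π m = ![0, m, l] (σ 1) := hσ 1
    have hσ2 : π l = ![0, m, l] (σ 2) := hσ 2
    constructor
    · rintro ⟨h, -, -, i, l', m', hi, hl', hm', h1, h2, h3⟩
      have ei : i = 0 := Fin.ext hi
      have el : l' = l := Fin.ext (by simp only [hl, Fin.val_last]; omega)
      have em : m' = m := Fin.ext hm'
      rw [ei, el] at h1
      rw [el, em] at h2
      rw [em, ei] at h3
      refine ⟨⟨?_, ?_, ?_⟩, h.restrict hg hτ, fun a b hab hb => ?_, fun a b hab ha hb => ?_⟩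
      · exact hf.injective (hσ0.symm.trans h1)
      · exact hf.injective (hσ2.symm.trans h2)
      · exact hf.injective (hσ1.symm.trans h3)
      -- An ascent before position `m` ends in a `231` at `m`, where `π` is `0`.
      · by_contra hle
        have hne : τ a ≠ τ b := fun e => hab.ne (τ.injective e)
        refine h (middleEmb j a) (middleEmb j b) m (hg hab) ((hlt b).2 hb) ?_ ?_
        · rw [h3, hτ]; exact hpos _
        · rw [hτ, hτ]; exact hg (lt_of_le_of_ne (not_lt.1 hle) hne)
      -- An ascent among the values above `m` ends in a `231` at the last position.
      · by_contra hle
        have hne : τ a ≠ τ b := fun e => hab.ne (τ.injective e)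
        refine h (middleEmb j a) (middleEmb j b) l (hg hab) (hlast b) ?_ ?_
        · rw [h2, hτ]; exact (hgt _).2 ha
        · rw [hτ, hτ]; exact hg (lt_of_le_of_ne (not_lt.1 hle) hne)
    · rintro ⟨⟨e0, e2, e1⟩, h, hd, hv⟩
      rw [e0] at hσ0
      rw [e1] at hσ1
      rw [e2] at hσ2
      replace hσ0 : π 0 = l := hσ0
      replace hσ1 : π m = 0 := hσ1
      replace hσ2 : π l = m := hσ2
      refine ⟨?_, by omega, by omega, 0, l, m, rfl, rfl, rfl, hσ0, hσ2, hσ1⟩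
      intro a b c hab hbc hca hab'
      have ha0 : a ≠ 0 := by
        rintro rfl
        rw [hσ0] at hab'
        exact absurd hab' (not_lt.2 (Fin.le_last _))
      have ham : a ≠ m := by
        rintro rfl
        rw [hσ1] at hca
        exact absurd hca (not_lt.2 (Fin.zero_le _))
      have hbm : b ≠ m := by
        rintro rfl
        rw [hσ1] at hab'
        exact absurd hab' (not_lt.2 (Fin.zero_le _))
      have hbl : b ≠ l := (hbc.trans_le (Fin.le_last c)).ne
      have hal : a ≠ l := (hab.trans_le (Fin.le_last b)).ne
      have hb0 : b ≠ 0 := ((Fin.zero_le _).trans_lt hab).ne'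
      obtain ⟨a, rfl⟩ := hmid a ha0 ham hal
      obtain ⟨b, rfl⟩ := hmid b hb0 hbm hbl
      have hab2 : a < b := hg.lt_iff_lt.1 hab
      rw [hτ, hτ] at hab'
      rw [hτ] at hca
      have hab3 : τ a < τ b := hg.lt_iff_lt.1 hab'
      by_cases hcm : c = m
      · rw [hcm] at hbc
        exact lt_asymm hab3 (hd a b hab2 ((hlt b).1 hbc))
      by_cases hcl : c = l
      · rw [hcl, hσ2] at hca
        exact lt_asymm hab3 (hv a b hab2 ((hgt _).1 hca) ((hgt _).1 (hca.trans hab')))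
      · obtain ⟨c, rfl⟩ := hmid c ((Fin.zero_le _).trans_lt hbc).ne' hcm hcl
        rw [hτ] at hca
        exact h a b c hab2 (hg.lt_iff_lt.1 hbc) (hg.lt_iff_lt.1 hca) hab3

end Recurrences

/-! ### Generating functions by size -/

section GeneratingFunction

variable {R : Type*} [CommRing R]

/-- The series `∑ₙ wₙ zⁿ`, where `wₙ` is the total weight of the `231`-avoiders of size `n`. -/
noncomputable def avoiderSeries (u : ℕ → R) : PowerSeries R :=
  PowerSeries.mk fun n => weightSum u n Avoids231

/-- The generating function of the decreasing permutations. -/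
noncomputable def decreasingSeries (u : ℕ → R) : PowerSeries R :=
  PowerSeries.mk fun n => weightSum u n IsDecreasing

/-- The generating function of the avoiders with an outer `3`-cycle. -/
noncomputable def outerCycleSeries (u : ℕ → R) : PowerSeries R :=
  PowerSeries.mk fun n => ∑ j ∈ Finset.range n, weightSum u n (HasOuterCycle j)

/-- The generating function of the pairs of a cut `s` and a permutation that is doubly decreasing
at `s`. -/
noncomputable def doublyDecreasingSeries (u : ℕ → R) : PowerSeries R :=
  PowerSeries.mk fun n => ∑ s ∈ Finset.range (n + 1), weightSum u n (IsDoublyDecreasing s)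

/-- The generating function of the pairs of a decreasing permutation and a cut strictly inside
it. There are `n - 1` such cuts for `0 < n`, and none, instead of `-1`, for `n = 0`. -/
noncomputable def cutDecreasingSeries (u : ℕ → R) : PowerSeries R :=
  PowerSeries.mk fun n => ((n : R) - 1) * weightSum u n IsDecreasing + if n = 0 then 1 else 0

open PowerSeries

theorem decreasingSeries_eq (u : ℕ → R) :
    decreasingSeries u = 1 + C (u 1) * X + C (u 2) * X ^ 2 * decreasingSeries u := by
  ext n
  rw [mul_assoc (C (u 2))]
  simp only [map_add, coeff_C_mul, coeff_X_pow_mul', decreasingSeries, coeff_mk, coeff_one, coeff_X]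
  rcases n with _ | _ | n
  · simp [weightSum_isDecreasing_zero]
  · simp [weightSum_isDecreasing_one]
  · rw [show n + 1 + 1 - 2 = n from rfl]
    simp [weightSum_isDecreasing_add_two]

theorem cutDecreasingSeries_eq (u : ℕ → R) :
    cutDecreasingSeries u = C (u 2) * X ^ 2 * cutDecreasingSeries u +
      2 * (C (u 2) * X ^ 2 * decreasingSeries u) - C (u 2) * X ^ 2 := by
  ext n
  rw [mul_assoc (C (u 2)), mul_assoc (C (u 2)), two_mul]
  simp only [map_add, map_sub, coeff_C_mul, coeff_X_pow_mul', decreasingSeries,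
    cutDecreasingSeries, coeff_mk, coeff_X_pow]
  rcases n with _ | _ | n
  · simp [weightSum_isDecreasing_zero]
  · simp
  · rcases n with _ | n
    · simp [weightSum_isDecreasing_add_two]
      ring
    · rw [show n + 1 + 1 + 1 - 2 = n + 1 from rfl]
      simp [weightSum_isDecreasing_add_two]
      ring

theorem sum_inner_cuts (n : ℕ) (c : R) :
    ∑ s ∈ Finset.range (n + 1), (if 0 < s ∧ s < n then c else 0) =
      ((n : R) - 1) * c + if n = 0 then c else 0 := by
  rcases n with _ | n
  · simp
  · rw [← Finset.sum_filter,
      show (Finset.range (n + 1 + 1)).filter (fun s => 0 < s ∧ s < n + 1) = Finset.Ioo 0 (n + 1) by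
        ext s; simp; omega]
    simp

theorem doublyDecreasingSeries_eq {u : ℕ → R} (hu : ∀ k, 3 < k → u k = 0) :
    doublyDecreasingSeries u = decreasingSeries u * decreasingSeries u + cutDecreasingSeries u +
      2 * outerCycleSeries u := by
  ext n
  rw [two_mul]
  simp only [map_add, coeff_mul, decreasingSeries, cutDecreasingSeries, outerCycleSeries,
    doublyDecreasingSeries, coeff_mk]
  rw [Finset.Nat.sum_antidiagonal_eq_sum_range_succ
      (fun i j => weightSum u i IsDecreasing * weightSum u j IsDecreasing),
    Finset.sum_congr rfl fun s hs => weightSum_isDoublyDecreasing hu (n := n) (s := s)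
      (by rw [Finset.mem_range] at hs; omega)]
  rw [Finset.sum_add_distrib, Finset.sum_add_distrib, Finset.sum_add_distrib, sum_inner_cuts,
    Finset.sum_range_succ fun s => weightSum u n (HasOuterCycle s),
    Finset.sum_range_succ' fun s => weightSum u n (HasOuterCycle (s - 1)),
    weightSum_hasOuterCycle_eq_zero u (j := n) (by omega),
    weightSum_hasOuterCycle_eq_zero u (j := 0 - 1) (by omega)]
  have h0 : (if n = 0 then weightSum u n IsDecreasing else 0) = if n = 0 then (1 : R) else 0 := by
    split_ifs with h
    · rw [h, weightSum_isDecreasing_zero]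
    · rfl
  rw [h0]
  simp only [Nat.add_sub_cancel]
  ring

theorem outerCycleSeries_eq (u : ℕ → R) :
    outerCycleSeries u = C (u 3) * X ^ 3 * doublyDecreasingSeries u := by
  ext n
  rw [mul_assoc (C (u 3))]
  simp only [coeff_C_mul, coeff_X_pow_mul', outerCycleSeries, doublyDecreasingSeries, coeff_mk]
  split_ifs with h
  · obtain ⟨n, rfl⟩ := Nat.exists_eq_add_of_le' h
    rw [Finset.sum_range_succ', Finset.sum_range_succ, Nat.add_sub_cancel, Finset.mul_sum,
      weightSum_hasOuterCycle_eq_zero u (j := 0) (by omega),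
      weightSum_hasOuterCycle_eq_zero u (j := n + 1 + 1) (by omega), add_zero, add_zero]
    exact Finset.sum_congr rfl fun j hj =>
      weightSum_hasOuterCycle u (by rw [Finset.mem_range] at hj; omega)
  · rw [mul_zero]
    exact Finset.sum_eq_zero fun j hj => weightSum_hasOuterCycle_eq_zero u
      (by rw [Finset.mem_range] at hj; omega)

theorem weightSum_avoids_zero (u : ℕ → R) : weightSum u 0 Avoids231 = 1 := by
  rw [weightSum_eq_of_unique u 1
    fun π => ⟨fun _ => Subsingleton.elim _ _, fun _ a => a.elim0⟩, cycleWeight_eq]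
  simp

theorem avoiderSeries_eq {u : ℕ → R} (hu : ∀ k, 3 < k → u k = 0) :
    avoiderSeries u =
      1 + avoiderSeries u * (decreasingSeries u - 1 + outerCycleSeries u) := by
  ext n
  have hcoeff : ∀ k, coeff k (decreasingSeries u - 1 + outerCycleSeries u) =
      if k = 0 then 0 else weightSum u k IsTop := by
    intro k
    simp only [map_add, map_sub, decreasingSeries, outerCycleSeries, coeff_mk, coeff_one]
    split_ifs with h
    · subst h
      simp [weightSum_isDecreasing_zero]
    · rw [weightSum_isTop hu (by omega), sub_zero]
  rw [map_add, coeff_mul]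
  simp only [hcoeff, avoiderSeries, coeff_mk, coeff_one]
  rw [Finset.Nat.sum_antidiagonal_eq_sum_range_succ
      (fun i j => weightSum u i Avoids231 * if j = 0 then 0 else weightSum u j IsTop),
    Finset.sum_range_succ]
  simp only [Nat.sub_self, if_true, mul_zero, add_zero]
  rcases n with _ | n
  · simp [weightSum_avoids_zero]
  · rw [if_neg (Nat.succ_ne_zero n), zero_add, weightSum_avoids u (Nat.succ_pos n)]
    refine Finset.sum_congr rfl fun a ha => ?_
    rw [Finset.mem_range] at ha
    rw [if_neg (by omega)]

/-- Eliminating the auxiliary series from their functional equations. -/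
theorem avoiderSeries_mul_denB {u : ℕ → R} (hu : ∀ k, 3 < k → u k = 0) :
    avoiderSeries u * denB (C (u 1) * X) (C (u 2) * X ^ 2) (C (u 3) * X ^ 3) =
      numB (C (u 2) * X ^ 2) (C (u 3) * X ^ 3) := by
  have hD := decreasingSeries_eq u
  have hE := cutDecreasingSeries_eq u
  have hP := doublyDecreasingSeries_eq hu
  have hT := outerCycleSeries_eq u
  have hW := avoiderSeries_eq hu
  generalize avoiderSeries u = W at *
  generalize decreasingSeries u = D at *
  generalize cutDecreasingSeries u = E at *
  generalize doublyDecreasingSeries u = P at *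
  generalize outerCycleSeries u = T at *
  generalize C (u 1) * X = t at *
  generalize C (u 2) * X ^ 2 = x at *
  generalize C (u 3) * X ^ 3 = y at *
  have h1 : (1 - x) * D = 1 + t := by linear_combination hD
  have h2 : (1 - x) ^ 2 * E = 2 * x * (1 + t) - x * (1 - x) := by
    linear_combination (1 - x) * hE + 2 * x * h1
  have h3 : (1 - x) ^ 2 * (1 - 2 * y) * T =
      y * ((1 + t) ^ 2 + 2 * x * (1 + t) - x * (1 - x)) := by
    linear_combination (1 - x) ^ 2 * hT + (1 - x) ^ 2 * y * hP + y * h2 +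
      y * ((1 - x) * D + 1 + t) * h1
  unfold denB numB
  linear_combination (1 - x) ^ 2 * (1 - 2 * y) * hW + W * h3 + W * (1 - x) * (1 - 2 * y) * h1

end GeneratingFunction

/-! ### Specializing the weights -/

theorem avoids_p231_iff {n : ℕ} (π : Perm (Fin n)) : Avoids π p231 ↔ Avoids231 π := by
  constructor
  · intro h a b c hab hbc hca hab'
    have hmono : StrictMono ![a, b, c] := by
      intro i j hij
      have hac := hab.trans hbc
      fin_cases i <;> fin_cases j <;> simp_all
    refine h ⟨OrderEmbedding.ofStrictMono ![a, b, c] hmono, fun i j => ?_⟩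
    have hcb := hca.trans hab'
    fin_cases i <;> fin_cases j <;>
      simp [p231, hca, hab', hcb, hca.le, hab'.le, hcb.le]
  · rintro h ⟨f, hf⟩
    exact h (f 0) (f 1) (f 2) (f.strictMono (by decide)) (f.strictMono (by decide))
      ((hf 2 0).2 (by decide)) ((hf 0 1).2 (by decide))

theorem prod_map_indicator (S : Finset ℕ) (m : Multiset ℕ) :
    (m.map fun k => if k ∈ S then (1 : ℚ) else 0).prod = if ∀ k ∈ m, k ∈ S then 1 else 0 := by
  induction m using Multiset.induction_on with
  | empty => simp
  | cons a m ih =>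
    rw [Multiset.map_cons, Multiset.prod_cons, ih]
    by_cases ha : a ∈ S <;> simp [ha]

/-- With indicator weights the weighted count is the plain count. -/
theorem genA_eq_avoiderSeries (S : Finset ℕ) :
    genA (S : Set ℕ) p231 = avoiderSeries fun k => if k ∈ S then (1 : ℚ) else 0 := by
  classical
  ext n
  rw [genA, avoiderSeries, PowerSeries.coeff_mk, PowerSeries.coeff_mk, weightSum]
  have hset : avoiders n (S : Set ℕ) p231 =
      ↑(Finset.univ.filter fun π : Perm (Fin n) => Avoids231 π ∧ CyclesIn (S : Set ℕ) π) := by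
    ext π
    simp [avoiders, avoids_p231_iff, and_comm]
  rw [hset, Set.ncard_coe_finset, Finset.card_filter, Nat.cast_sum]
  refine Finset.sum_congr rfl fun π _ => ?_
  rw [cycleWeight, prod_map_indicator]
  by_cases h1 : Avoids231 π <;> simp [h1, CyclesIn]

/-- The weights `t`, `x`, `y` of the cycles of length `1`, `2`, `3`. -/
noncomputable def variableWeight (k : ℕ) : MvPowerSeries (Fin 3) ℚ :=
  if k = 1 then MvPowerSeries.X 0 else if k = 2 then MvPowerSeries.X 1 else
    if k = 3 then MvPowerSeries.X 2 else 0

theorem prod_map_variableWeight (m : Multiset ℕ) :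
    (m.map variableWeight).prod =
      if ∀ k ∈ m, k ∈ ({1, 2, 3} : Set ℕ) then
        (MvPowerSeries.X 0 ^ m.count 1 * MvPowerSeries.X 1 ^ m.count 2 *
          MvPowerSeries.X 2 ^ m.count 3 : MvPowerSeries (Fin 3) ℚ) else 0 := by
  classical
  induction m using Multiset.induction_on with
  | empty => simp
  | cons a m ih =>
    rw [Multiset.map_cons, Multiset.prod_cons, ih]
    by_cases hm : ∀ k ∈ m, k ∈ ({1, 2, 3} : Set ℕ)
    · by_cases ha : a ∈ ({1, 2, 3} : Set ℕ)
      · have hall : ∀ k ∈ a ::ₘ m, k ∈ ({1, 2, 3} : Set ℕ) := by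
          intro k hk
          rcases Multiset.mem_cons.1 hk with rfl | hk
          exacts [ha, hm k hk]
        rw [if_pos hm, if_pos hall, Multiset.count_cons, Multiset.count_cons, Multiset.count_cons]
        simp only [Set.mem_insert_iff, Set.mem_singleton_iff] at ha
        rcases ha with rfl | rfl | rfl <;> simp [variableWeight] <;> ring
      · have hnot : ¬ ∀ k ∈ a ::ₘ m, k ∈ ({1, 2, 3} : Set ℕ) :=
          fun h => ha (h a (Multiset.mem_cons_self a m))
        rw [if_neg hnot]
        simp only [Set.mem_insert_iff, Set.mem_singleton_iff, not_or] at ha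
        simp [variableWeight, ha]
    · rw [if_neg hm, if_neg fun h => hm fun k hk => h k (Multiset.mem_cons_of_mem hk), mul_zero]

theorem coeff_X_pow_mul_X_pow_mul_X_pow (d : Fin 3 →₀ ℕ) (a b c : ℕ) :
    MvPowerSeries.coeff d (MvPowerSeries.X 0 ^ a * MvPowerSeries.X 1 ^ b * MvPowerSeries.X 2 ^ c :
      MvPowerSeries (Fin 3) ℚ) = if a = d 0 ∧ b = d 1 ∧ c = d 2 then 1 else 0 := by
  classical
  rw [MvPowerSeries.X_pow_eq, MvPowerSeries.X_pow_eq, MvPowerSeries.X_pow_eq,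
    MvPowerSeries.monomial_mul_monomial, MvPowerSeries.monomial_mul_monomial,
    MvPowerSeries.coeff_monomial]
  have h : d = Finsupp.single 0 a + Finsupp.single 1 b + Finsupp.single 2 c ↔
      a = d 0 ∧ b = d 1 ∧ c = d 2 := by
    constructor
    · intro h
      rw [h]
      simp
    · rintro ⟨rfl, rfl, rfl⟩
      ext i
      fin_cases i <;> simp
  rw [if_congr h rfl rfl]
  simp

/-- A cycle type with `dₖ` cycles of length `k + 1` only occurs in size `d₀ + 2 d₁ + 3 d₂`, so
setting `z = 1` in a series whose `zⁿ` is redundant amounts to reading off, for each `d`, the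
coefficient of `z` to this power. -/
noncomputable def setSizeOne :
    PowerSeries (MvPowerSeries (Fin 3) ℚ) →+ MvPowerSeries (Fin 3) ℚ where
  toFun F d := MvPowerSeries.coeff d (PowerSeries.coeff (d 0 + 2 * d 1 + 3 * d 2) F)
  map_zero' := by
    funext d
    simp only [map_zero]
    rfl
  map_add' F G := by
    funext d
    simp only [map_add]
    rfl

theorem coeff_setSizeOne (F : PowerSeries (MvPowerSeries (Fin 3) ℚ)) (d : Fin 3 →₀ ℕ) :
    MvPowerSeries.coeff d (setSizeOne F) =
      MvPowerSeries.coeff d (PowerSeries.coeff (d 0 + 2 * d 1 + 3 * d 2) F) := rfl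

/-- The substitution `z = 1` turns `t z`, `x z²`, `y z³` into `t`, `x`, `y`. -/
theorem setSizeOne_mul (s : Fin 3) (F : PowerSeries (MvPowerSeries (Fin 3) ℚ)) :
    setSizeOne (PowerSeries.C (MvPowerSeries.X s) * PowerSeries.X ^ (s.val + 1) * F) =
      MvPowerSeries.X s * setSizeOne F := by
  classical
  ext d
  rw [coeff_setSizeOne, mul_assoc, PowerSeries.coeff_C_mul, PowerSeries.coeff_X_pow_mul',
    MvPowerSeries.X, MvPowerSeries.coeff_monomial_mul, MvPowerSeries.coeff_monomial_mul,
    coeff_setSizeOne]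
  by_cases h : Finsupp.single s 1 ≤ d
  · have hs : 1 ≤ d s := Finsupp.single_le_iff.1 h
    rw [if_pos h, if_pos h]
    fin_cases s
    · have hs' : 1 ≤ d 0 := hs
      rw [if_pos (by simp; omega)]
      simp [Finsupp.tsub_apply]
      congr 3
      omega
    · have hs' : 1 ≤ d 1 := hs
      rw [if_pos (by simp; omega)]
      simp [Finsupp.tsub_apply]
      congr 3
      omega
    · have hs' : 1 ≤ d 2 := hs
      rw [if_pos (by simp; omega)]
      simp [Finsupp.tsub_apply]
      congr 3
      omega
  · rw [if_neg h, if_neg h]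

theorem setSizeOne_one : setSizeOne 1 = 1 := by
  classical
  ext d
  rw [coeff_setSizeOne, PowerSeries.coeff_one, MvPowerSeries.coeff_one]
  by_cases hd : d = 0
  · simp [hd]
  · rw [if_neg hd, if_neg, map_zero]
    intro h
    apply hd
    ext i
    fin_cases i <;> simp <;> omega

theorem genB_eq_setSizeOne : genB = setSizeOne (avoiderSeries variableWeight) := by
  classical
  ext d
  rw [coeff_genB, coeff_setSizeOne, avoiderSeries, PowerSeries.coeff_mk, weightSum, map_sum]
  set n := d 0 + 2 * d 1 + 3 * d 2
  have hset : refined n (d 0) (d 1) (d 2) =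
      ↑(Finset.univ.filter fun π : Perm (Fin n) => Avoids231 π ∧ CyclesIn {1, 2, 3} π ∧
        cycleCount 1 π = d 0 ∧ cycleCount 2 π = d 1 ∧ cycleCount 3 π = d 2) := by
    ext π
    simp only [refined, avoiders, avoids_p231_iff, Finset.coe_filter, Finset.mem_univ, true_and,
      Set.mem_ofPred_eq]
    tauto
  rw [hset, Set.ncard_coe_finset, Finset.card_filter, Nat.cast_sum]
  refine Finset.sum_congr rfl fun π _ => ?_
  rw [cycleWeight, prod_map_variableWeight]
  by_cases h1 : Avoids231 π
  · by_cases h2 : CyclesIn {1, 2, 3} π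
    · have h2' : ∀ k ∈ π.partition.parts, k ∈ ({1, 2, 3} : Set ℕ) := h2
      rw [if_pos h1, if_pos h2', coeff_X_pow_mul_X_pow_mul_X_pow]
      simp [h1, h2, cycleCount]
    · have h2' : ¬ ∀ k ∈ π.partition.parts, k ∈ ({1, 2, 3} : Set ℕ) := h2
      rw [if_pos h1, if_neg h2']
      simp [h2]
  · simp [h1]

theorem genB_mul_denB :
    genB * denB (MvPowerSeries.X 0) (MvPowerSeries.X 1) (MvPowerSeries.X 2) =
      numB (MvPowerSeries.X 1) (MvPowerSeries.X 2) := by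
  have h := avoiderSeries_mul_denB (u := variableWeight) fun k hk => by
    rw [variableWeight, if_neg (by omega), if_neg (by omega), if_neg (by omega)]
  have h0 := setSizeOne_mul 0
  have h1 := setSizeOne_mul 1
  have h2 := setSizeOne_mul 2
  rw [show variableWeight 1 = MvPowerSeries.X 0 by simp [variableWeight],
    show variableWeight 2 = MvPowerSeries.X 1 by simp [variableWeight],
    show variableWeight 3 = MvPowerSeries.X 2 by simp [variableWeight]] at h
  simp only [Fin.val_zero, Fin.val_one, Fin.val_two, zero_add, pow_one, Nat.reduceAdd] at h0 h1 h2
  rw [genB_eq_setSizeOne]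
  generalize avoiderSeries variableWeight = W at *
  generalize PowerSeries.C (MvPowerSeries.X 0 : MvPowerSeries (Fin 3) ℚ) * PowerSeries.X = t at *
  generalize PowerSeries.C (MvPowerSeries.X 1 : MvPowerSeries (Fin 3) ℚ) * PowerSeries.X ^ 2 = x at *
  generalize PowerSeries.C (MvPowerSeries.X 2 : MvPowerSeries (Fin 3) ℚ) * PowerSeries.X ^ 3 = y at *
  -- `setSizeOne` is only additive, so both sides are expanded into iterated multiplications by
  -- `t`, `x` and `y`, to which the three rules apply.
  have hW : W * denB t x y = W - 3 • (x * W) - 3 • (y * W) - t * W + 2 • (x * (x * W)) +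
      5 • (x * (y * W)) + t * (x * W) - 5 • (x * (x * (y * W))) - 4 • (t * (x * (y * W))) -
      t * (t * (y * W)) := by
    unfold denB
    simp only [nsmul_eq_mul]
    push_cast
    ring
  have hN : numB x y = 1 - 2 • (x * 1) + x * (x * 1) - 2 • (y * 1) + 4 • (x * (y * 1)) -
      2 • (x * (x * (y * 1))) := by
    unfold numB
    simp only [nsmul_eq_mul]
    push_cast
    ring
  rw [hW, hN] at h
  have h' := congrArg setSizeOne h
  simp only [map_sub, map_add, map_nsmul, h0, h1, h2, setSizeOne_one] at h'
  simp only [nsmul_eq_mul] at h'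
  unfold denB numB
  push_cast at h'
  linear_combination h'

theorem specialization_zero (S : Finset ℕ) : specialization S 0 =
    PowerSeries.C (if 1 ∈ S then (1 : ℚ) else 0) * PowerSeries.X := by
  simp only [specialization, Matrix.cons_val]
  split_ifs <;> simp

theorem specialization_one (S : Finset ℕ) : specialization S 1 =
    PowerSeries.C (if 2 ∈ S then (1 : ℚ) else 0) * PowerSeries.X ^ 2 := by
  simp only [specialization, Matrix.cons_val]
  split_ifs <;> simp

theorem specialization_two (S : Finset ℕ) : specialization S 2 =
    PowerSeries.C (if 3 ∈ S then (1 : ℚ) else 0) * PowerSeries.X ^ 3 := by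
  simp only [specialization, Matrix.cons_val]
  split_ifs <;> simp

theorem constantCoeff_denB_specialization (S : Finset ℕ) :
    PowerSeries.constantCoeff (denB (specialization S 0) (specialization S 1)
      (specialization S 2)) = 1 := by
  have h0 : PowerSeries.constantCoeff (specialization S 0) = 0 := by
    rw [specialization_zero, map_mul, PowerSeries.constantCoeff_X, mul_zero]
  have h1 : PowerSeries.constantCoeff (specialization S 1) = 0 := by
    rw [specialization_one, map_mul, map_pow, PowerSeries.constantCoeff_X, zero_pow two_ne_zero,
      mul_zero]
  have h2 : PowerSeries.constantCoeff (specialization S 2) = 0 := by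
    rw [specialization_two, map_mul, map_pow, PowerSeries.constantCoeff_X, zero_pow three_ne_zero,
      mul_zero]
  unfold denB
  simp only [map_sub, map_add, map_mul, map_pow, map_one, h0, h1, h2]
  norm_num

theorem genA_mul_denB {S : Finset ℕ} (hS : S ⊆ {1, 2, 3}) :
    genA (S : Set ℕ) p231 *
        denB (specialization S 0) (specialization S 1) (specialization S 2) =
      numB (specialization S 1) (specialization S 2) := by
  rw [genA_eq_avoiderSeries, specialization_zero, specialization_one, specialization_two]
  refine avoiderSeries_mul_denB fun k hk => if_neg fun hkS => ?_
  have := hS hkS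
  simp only [Finset.mem_insert, Finset.mem_singleton] at this
  omega

theorem subst_genB_mul_denB (S : Finset ℕ) :
    (MvPowerSeries.subst (specialization S) genB : PowerSeries ℚ) *
        denB (specialization S 0) (specialization S 1) (specialization S 2) =
      numB (specialization S 1) (specialization S 2) := by
  have h := congrArg (MvPowerSeries.substAlgHom (R := ℚ) (hasSubst_specialization S)) genB_mul_denB
  unfold denB numB at h ⊢
  simp only [map_mul, map_sub, map_add, map_pow, map_one, map_ofNat,
    MvPowerSeries.substAlgHom_X] at h
  rw [MvPowerSeries.substAlgHom_apply] at h
  exact h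

end CyclePattern

theorem mainTheorem2 :
    MvPowerSeries.constantCoeff (CyclePattern.denB
        (MvPowerSeries.X 0 : MvPowerSeries (Fin 3) ℚ) (MvPowerSeries.X 1) (MvPowerSeries.X 2)) ≠ 0 ∧
    CyclePattern.genB =
      CyclePattern.numB (MvPowerSeries.X 1) (MvPowerSeries.X 2) *
        (CyclePattern.denB (MvPowerSeries.X 0) (MvPowerSeries.X 1) (MvPowerSeries.X 2))⁻¹ ∧
    ∀ S : Finset ℕ, S ⊆ {1, 2, 3} →
      CyclePattern.genA (S : Set ℕ) CyclePattern.p231 =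
        MvPowerSeries.subst (CyclePattern.specialization S) CyclePattern.genB ∧
      PowerSeries.constantCoeff (CyclePattern.denB (CyclePattern.specialization S 0)
        (CyclePattern.specialization S 1) (CyclePattern.specialization S 2)) ≠ 0 ∧
      CyclePattern.genA (S : Set ℕ) CyclePattern.p231 =
        CyclePattern.numB (CyclePattern.specialization S 1) (CyclePattern.specialization S 2) *
          (CyclePattern.denB (CyclePattern.specialization S 0)
            (CyclePattern.specialization S 1) (CyclePattern.specialization S 2))⁻¹ := by
  have hden : MvPowerSeries.constantCoeff (CyclePattern.denB
      (MvPowerSeries.X 0 : MvPowerSeries (Fin 3) ℚ) (MvPowerSeries.X 1) (MvPowerSeries.X 2)) ≠ 0 := by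
    simp [CyclePattern.denB]
  refine ⟨hden, ?_, fun S hS => ?_⟩
  · rw [MvPowerSeries.eq_mul_inv_iff_mul_eq hden]
    exact CyclePattern.genB_mul_denB
  · have hdenS : PowerSeries.constantCoeff (CyclePattern.denB (CyclePattern.specialization S 0)
        (CyclePattern.specialization S 1) (CyclePattern.specialization S 2)) ≠ 0 := by
      rw [CyclePattern.constantCoeff_denB_specialization]
      exact one_ne_zero
    have hA := (PowerSeries.eq_mul_inv_iff_mul_eq hdenS).2 (CyclePattern.genA_mul_denB hS)
    have hB := (PowerSeries.eq_mul_inv_iff_mul_eq hdenS).2 (CyclePattern.subst_genB_mul_denB S)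
    exact ⟨hA.trans hB.symm, hdenS, hA⟩
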